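/- Let $d\ge 1$ and $r\ge 1$ be integers, let $\tau\in S_d$ be a $d$-cycle (for $d=1$, the identity of $S_1$), let $e_1,\dots,e_{r-1}\ge 2$ be integers, and let $S=\{s_1<s_2<\dots<s_{r-1}\}$ be a finite totally ordered set disjoint from $[d]=\{1,\dots,d\}$. Products of permutations are composed from right to left. An $S$-$[d]$ bipartite graph is a simple graph with vertex set $S\cup[d]$ each of whose edges joins a vertex of $S$ to a vertex of $[d]$. A factorization of $\tau$ of type $(e_1,\dots,e_{r-1})$ is a tuple $(\sigma_1,\dots,\sigma_{r-1})$ such that each $\sigma_j\in S_d$ is an $e_j$-cycle and $\sigma_1\cdots\sigma_{r-1}=\tau$. Its factorization graph is the $S$-$[d]$ bipartite graph whose edges are the pairs $\{s_j,\nu\}$ with $\nu$ in the support of $\sigma_j$. A graph is a factorization graph of type $(d,r,\tau;e_1,\dots,e_{r-1})$ if it arises in this way from some such factorization. Let $\mathcal C_\tau$ be the circle on which the elements of $[d]$ are placed so that the clockwise successor of $x$ is $\tau(x)$. A consecutive piece is a set of the form $\{x,\tau(x),\dots,\tau^{m-1}(x)\}$. * An $S$-vertex $s$ of an $S$-$[d]$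 bipartite graph $G$ has the consecutive partition property (CPP) on $(G,\tau)$ if, after $s$ and its incident edges are removed from $G$, the sets of $[d]$-vertices of the connected components partition $\mathcal C_\tau$ into (nonempty) consecutive pieces. * A $[d]$-vertex $\nu$ of $G$ has the counterclockwise increasing consecutive partition property (CICPP) on $(G,\tau)$ if, after $\nu$ and its incident edges are removed from $G$, (a) the sets of $[d]$-vertices of the connected components partition $[d]\setminus\{\nu\}$ into (nonempty) consecutive pieces of $\mathcal C_\tau$; and (b) whenever $s<s'$ are $S$-vertices adjacent to $\nu$ in $G$, every $[d]$-vertex of the component of $s$ is met before every $[d]$-vertex of the component of $s'$ when $\mathcal C_\tau$ is traversed counterclockwise starting from $\nu$. **Proposition.** Let $G$ be an $S$-$[d]$ bipartite graph in which $s_j$ has degree $e_j$ for every $1\le j\le r-1$. Then $\sum_{j=1}^{r-1}(e_j-1)=d-1$ and $G$ is a factorization graph of type $(d,r,\tau;e_1,\dots,e_{r-1})$ if and only if 1. $G$ is a tree (connected and acyclic), and 2. every $[d]$-vertex of $G$ has CICPP on $(G,\tau)$. Moreover, if $\sum_{j=1}^{r-1}(e_j-1)=d-1$ and $G$ is a factorization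 graph of type $(d,r,\tau;e_1,\dots,e_{r-1})$, then 3. every $S$-vertex of $G$ has CPP on $(G,\tau)$. -/

import Mathlib

open Equiv

/-- The tuple `(σ_1, …, σ_n)` of permutations of `α` is a factorization of `τ` of type
`(e_1, …, e_n)`: each `σ_j` is an `e_j`-cycle (the `e_j` are at least `2` throughout), and
`σ_1 σ_2 ⋯ σ_n = τ`, where in a product the rightmost factor is applied first. -/
structure IsFactorizationOfType {α : Type*} [Fintype α] [DecidableEq α] {n : ℕ}
    (τ : Perm α) (e : Fin n → ℕ) (σ : Fin n → Perm α) : Prop where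
  isCycle : ∀ j, (σ j).IsCycle
  card_support : ∀ j, (σ j).support.card = e j
  prod_eq : (List.ofFn σ).prod = τ

/-- The bipartite graph associated to `(σ_1, …, σ_n)`: its vertex set is the disjoint union of
`S = {s_1 < ⋯ < s_n}` and `α`, and its edges are the pairs `{s_j, ν}` with `ν` in the support
of `σ_j`. -/
def factorizationGraph {S α : Type*} [Fintype α] [DecidableEq α] {n : ℕ}
    (s : Fin n → S) (σ : Fin n → Perm α) : SimpleGraph (S ⊕ α) where
  Adj v w := ∃ j, ∃ ν ∈ (σ j).support, s(v, w) = s(Sum.inl (s j), Sum.inr ν)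
  symm := ⟨fun v w h => by rwa [Sym2.eq_swap (a := w) (b := v)]⟩
  loopless := ⟨fun v h => by
    obtain ⟨j, ν, -, h⟩ := h
    rcases Sym2.eq_iff.mp h with ⟨h1, h2⟩ | ⟨h1, h2⟩ <;> simp [h1] at h2⟩

/-- `G` is a bipartite graph between `S = {s_1 < ⋯ < s_n}` and `α` (every edge connects an
`S`-vertex to an `α`-vertex) in which `s_j` has degree `e_j`. -/
structure IsBipartiteOfType {S α : Type*} {n : ℕ} (s : Fin n → S) (e : Fin n → ℕ)
    (G : SimpleGraph (S ⊕ α)) : Prop where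
  isBipartiteWith : G.IsBipartiteWith (Set.range Sum.inl) (Set.range Sum.inr)
  ncard_neighborSet : ∀ j, (G.neighborSet (Sum.inl (s j))).ncard = e j

/-- `G` is the graph associated to some factorization of `τ` of type `(e_1, …, e_n)`. -/
def IsFactorizationGraph {S α : Type*} [Fintype α] [DecidableEq α] {n : ℕ}
    (τ : Perm α) (s : Fin n → S) (e : Fin n → ℕ) (G : SimpleGraph (S ⊕ α)) : Prop :=
  ∃ σ : Fin n → Perm α, IsFactorizationOfType τ e σ ∧ G = factorizationGraph s σ

/-- Remove the vertex `v` and its incident edges from `G`. For a connected component `c` of the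
graph that remains (one of the subtrees, if `G` is a tree) this is the set of vertices of `c`
that lie in `α`. -/
def componentTrace {S α : Type*} (G : SimpleGraph (S ⊕ α)) (v : S ⊕ α)
    (c : (G.induce {v}ᶜ).ConnectedComponent) : Set α :=
  {μ | ∃ h : Sum.inr μ ∈ ({v}ᶜ : Set (S ⊕ α)), ⟨Sum.inr μ, h⟩ ∈ c.supp}

/-- `P` is a consecutive piece of the circle `C_γ`, on which the clockwise successor of `x` is
`γ x`: it consists of some `x, γ x, …, γ^(m-1) x`. -/
def IsConsecutivePiece {α : Type*} (γ : Perm α) (P : Set α) : Prop :=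
  ∃ (x : α) (m : ℕ), P = {y | ∃ i < m, (γ ^ i) x = y}

/-- The sets `P k` partition the set `A` of nodes of the circle `C_γ` into consecutive pieces. -/
structure PartitionsIntoConsecutivePieces {α κ : Type*} (γ : Perm α) (A : Set α)
    (P : κ → Set α) : Prop where
  nonempty : ∀ k, (P k).Nonempty
  disjoint : Pairwise fun k l => Disjoint (P k) (P l)
  iUnion_eq : ⋃ k, P k = A
  consecutive : ∀ k, IsConsecutivePiece γ (P k)

/-- The number of counterclockwise steps on the circle `C_γ` that lead from `ν` to `μ`. -/
noncomputable def ccwSteps {α : Type*} (γ : Perm α) (ν μ : α) : ℕ :=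
  sInf {k : ℕ | (γ⁻¹ ^ k) ν = μ}

/-- The consecutive partition property of an `S`-vertex `t` on `(G, γ)`, for a bipartite tree `G`
and a cyclic permutation `γ` of all of `α`. -/
def HasCPP {S α : Type*} (G : SimpleGraph (S ⊕ α)) (γ : Perm α) (t : S) : Prop :=
  PartitionsIntoConsecutivePieces γ Set.univ (componentTrace G (Sum.inl t))

/-- The counterclockwise increasing consecutive partition property of an `α`-vertex `ν` on
`(G, γ)`, for a bipartite tree `G` and a cyclic permutation `γ` of all of `α`: the subtrees that
remain after the removal of `ν` partition the circle cut open at `ν` into consecutive pieces, and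
these pieces, met in counterclockwise order starting from `ν`, are in the increasing order of the
neighbours of `ν` that the subtrees contain. -/
structure HasCICPP {S α : Type*} [LinearOrder S] (G : SimpleGraph (S ⊕ α)) (γ : Perm α)
    (ν : α) : Prop where
  partition : PartitionsIntoConsecutivePieces γ {ν}ᶜ (componentTrace G (Sum.inr ν))
  increasing : ∀ t t' : S, G.Adj (Sum.inr ν) (Sum.inl t) → G.Adj (Sum.inr ν) (Sum.inl t') →
    t < t' → ∀ c c' : (G.induce {Sum.inr ν}ᶜ).ConnectedComponent,
      ⟨Sum.inl t, by simp⟩ ∈ c.supp → ⟨Sum.inl t', by simp⟩ ∈ c'.supp →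
        ∀ μ ∈ componentTrace G (Sum.inr ν) c, ∀ μ' ∈ componentTrace G (Sum.inr ν) c',
          ccwSteps γ ν μ < ccwSteps γ ν μ'

/-! Transitivity of `τ` makes a factorization graph connected, and a connected graph with `∑ e j`
edges on `n + d` vertices is a tree exactly when `∑ (e j - 1) = d - 1`. On such a tree CICPP at `ν`
is the order condition `BranchesIncrease`: it forces every branch at `ν` to be an arc, and it
follows from the local rule that, away from `ν`, `τ` never moves a point to a branch with a larger
label (`branchesIncrease_of_le`).

From a factorization to the order: apply the factors to `x`, rightmost first. The moving point can
change its branch at `ν` only by stopping at `ν`. It arrives through the factor that labels the old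
branch and leaves through one applied later, hence of smaller index.

Conversely, the block of `c` at `t` is the complement of the branch of `t` at `c`, so it is an arc
as well, which also gives CPP. The circle therefore visits the blocks at `t` in a cyclic order, and
this order is the cycle attached to `t` (`exists_isCycle_of_block`). The product of these cycles is
`τ` (`prod_eq_of_block`): the moving point follows the tree path from `x` to `τ x`, since the order
condition makes the labels decrease along that path and excludes every other move. -/

namespace SimpleGraph

/-! ### First steps of paths in a tree -/

variable {V : Type*} {G : SimpleGraph V}

open Classical in
/-- The second vertex of a path from `v` to `w` (and `v` itself if there is no such path). -/
noncomputable def towards (G : SimpleGraph V) (v w : V) : V :=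
  if h : ∃ p : G.Walk v w, p.IsPath then h.choose.snd else v

theorem IsAcyclic.towards_eq_snd (hG : G.IsAcyclic) {v w : V} {p : G.Walk v w} (hp : p.IsPath) :
    G.towards v w = p.snd := by
  have h : ∃ p : G.Walk v w, p.IsPath := ⟨p, hp⟩
  have := Subtype.mk.inj ((hG.subsingleton_path v w).elim ⟨h.choose, h.choose_spec⟩ ⟨p, hp⟩)
  rw [towards, dif_pos h, this]

theorem IsAcyclic.towards_self (hG : G.IsAcyclic) (v : V) : G.towards v v = v := by
  rw [hG.towards_eq_snd (Walk.IsPath.nil (u := v))]; rfl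

theorem IsAcyclic.towards_of_adj (hG : G.IsAcyclic) {v u : V} (h : G.Adj v u) :
    G.towards v u = u := by
  rw [hG.towards_eq_snd (Walk.IsPath.of_adj h)]; rfl

theorem IsTree.exists_isPath (hG : G.IsTree) (v w : V) : ∃ p : G.Walk v w, p.IsPath :=
  (hG.existsUnique_path v w).exists

theorem IsTree.adj_towards (hG : G.IsTree) {v w : V} (h : v ≠ w) : G.Adj v (G.towards v w) := by
  obtain ⟨p, hp⟩ := hG.exists_isPath v w
  rw [hG.isAcyclic.towards_eq_snd hp]
  exact p.adj_snd (Walk.not_nil_of_ne h)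

/-- Deleting the edge between `a` and `t` splits the tree in two, and `x` lies on exactly one side.
This makes branches complements of blocks. -/
theorem IsTree.towards_eq_iff (hG : G.IsTree) {a t : V} (h : G.Adj a t) (x : V) :
    G.towards a x = t ↔ G.towards t x ≠ a := by
  constructor
  · obtain ⟨p, hp⟩ := hG.exists_isPath a x
    rw [hG.isAcyclic.towards_eq_snd hp]
    cases p with
    | nil => rintro rfl; exact absurd h (G.irrefl)
    | cons h' q =>
      rw [Walk.snd_cons]
      rintro rfl
      rw [Walk.cons_isPath_iff] at hp
      rw [hG.isAcyclic.towards_eq_snd hp.1]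
      intro hq
      exact hp.2 (hq ▸ Walk.getVert_mem_support _ _)
  · intro ht
    obtain ⟨q, hq⟩ := hG.exists_isPath t x
    rw [hG.isAcyclic.towards_eq_snd hq] at ht
    have ha : a ∉ q.support := fun hmem =>
      ht (hG.isAcyclic.eq_snd_of_adj_start hq h.symm hmem).symm
    rw [hG.isAcyclic.towards_eq_snd (hq.cons ha (h := h)), Walk.snd_cons]

/-- Of the paths from `v` to `x` and to `y`, one extends the other by the edge `x y`; the shorter
one is not trivial, so the first steps agree. -/
theorem IsTree.towards_eq_towards (hG : G.IsTree) {v x y : V} (h : G.Adj x y) (hx : x ≠ v)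
    (hy : y ≠ v) : G.towards v x = G.towards v y := by
  have key : ∀ {x y : V} {p : G.Walk v x} (_ : p.IsPath) {q : G.Walk v y} (_ : q.IsPath),
      ∀ h : G.Adj x y, x ≠ v → q = p.concat h → G.towards v x = G.towards v y := by
    intro x y p hp q hq h hx e
    rw [hG.isAcyclic.towards_eq_snd hp, hG.isAcyclic.towards_eq_snd hq, e]
    cases p with
    | nil => exact absurd rfl hx
    | cons => rw [Walk.concat_cons, Walk.snd_cons, Walk.snd_cons]
  obtain ⟨p, hp⟩ := hG.exists_isPath v x
  obtain ⟨q, hq⟩ := hG.exists_isPath v y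
  by_cases hm : x ∈ q.support
  · exact key hp hq h hx (hG.isAcyclic.path_concat hp hq h hm)
  · have := hG.isAcyclic.mem_support_of_ne_mem_support_of_adj_of_isPath hp hq h hm
    exact (key hq hp h.symm hy (hG.isAcyclic.path_concat hq hp h.symm this)).symm

theorem IsTree.reachable_induce_towards (hG : G.IsTree) {v x : V} (hx : x ∈ ({v}ᶜ : Set V))
    (hu : G.towards v x ∈ ({v}ᶜ : Set V)) :
    (G.induce {v}ᶜ).Reachable ⟨G.towards v x, hu⟩ ⟨x, hx⟩ := by
  obtain ⟨p, hp⟩ := hG.exists_isPath v x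
  have e := hG.isAcyclic.towards_eq_snd hp
  cases p with
  | nil => exact absurd rfl hx
  | cons h q =>
    rw [Walk.snd_cons] at e
    rw [Walk.cons_isPath_iff] at hp
    subst e
    exact ⟨q.induce _ fun y hy => by rintro rfl; exact hp.2 hy⟩

theorem IsTree.towards_eq_of_reachable_induce (hG : G.IsTree) {v : V} {x y : ({v}ᶜ : Set V)}
    (h : (G.induce {v}ᶜ).Reachable x y) : G.towards v x = G.towards v y := by
  obtain ⟨w⟩ := h
  induction w with
  | nil => rfl
  | @cons a b _ h _ ih => exact (hG.towards_eq_towards (x := a) (y := b) h a.2 b.2).trans ih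

/-- The components of a tree with the vertex `v` removed correspond to the neighbours of `v`. -/
theorem IsTree.exists_mem_supp_iff_towards (hG : G.IsTree) {v : V}
    (c : (G.induce {v}ᶜ).ConnectedComponent) :
    ∃ u, G.Adj v u ∧ ∀ x (h : x ∈ ({v}ᶜ : Set V)), ⟨x, h⟩ ∈ c.supp ↔ G.towards v x = u := by
  induction c using ConnectedComponent.ind with | h z
  refine ⟨G.towards v z, hG.adj_towards (Ne.symm z.2), fun x h => ?_⟩
  rw [ConnectedComponent.mem_supp_iff, ConnectedComponent.eq]
  refine ⟨fun hr => hG.towards_eq_of_reachable_induce hr, fun e => ?_⟩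
  have hx : G.towards v x ∈ ({v}ᶜ : Set V) := (hG.adj_towards (Ne.symm h)).ne'
  have hz : G.towards v z ∈ ({v}ᶜ : Set V) := (hG.adj_towards (Ne.symm z.2)).ne'
  refine (hG.reachable_induce_towards h hx).symm.trans ?_
  convert hG.reachable_induce_towards z.2 hz

end SimpleGraph

/-! ### Counting counterclockwise steps on the circle -/

section Circle

variable {α : Type*} {τ : Perm α}

theorem inv_pow_ccwSteps [Finite α] (hτ : τ.IsCycleOn Set.univ) (ν μ : α) :
    (τ⁻¹ ^ ccwSteps τ ν μ) ν = μ := by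
  obtain ⟨k, hk⟩ := hτ.inv.exists_pow_eq' Set.finite_univ (Set.mem_univ ν) (Set.mem_univ μ)
  exact Nat.sInf_mem (s := {k : ℕ | (τ⁻¹ ^ k) ν = μ}) ⟨k, hk⟩

theorem ccwSteps_le {ν μ : α} {k : ℕ} (h : (τ⁻¹ ^ k) ν = μ) : ccwSteps τ ν μ ≤ k :=
  Nat.sInf_le h

theorem ccwSteps_injective [Finite α] (hτ : τ.IsCycleOn Set.univ) {ν x y : α}
    (h : ccwSteps τ ν x = ccwSteps τ ν y) : x = y := by
  rw [← inv_pow_ccwSteps hτ ν x, h, inv_pow_ccwSteps hτ]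

theorem ccwSteps_self (ν : α) : ccwSteps τ ν ν = 0 :=
  Nat.le_zero.1 (ccwSteps_le (by simp))

theorem ccwSteps_pos [Finite α] (hτ : τ.IsCycleOn Set.univ) {ν x : α} (h : x ≠ ν) :
    0 < ccwSteps τ ν x :=
  Nat.pos_of_ne_zero fun h0 => h (ccwSteps_injective hτ (h0.trans (ccwSteps_self ν).symm))

theorem ccwSteps_eq_add_one [Finite α] (hτ : τ.IsCycleOn Set.univ) {ν x : α} (h : x ≠ ν) :
    ccwSteps τ ν x = ccwSteps τ ν (τ x) + 1 := by
  apply le_antisymm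
  · apply ccwSteps_le
    rw [pow_succ', Perm.mul_apply, inv_pow_ccwSteps hτ, Perm.inv_def, Equiv.symm_apply_apply]
  · obtain ⟨k, hk⟩ := Nat.exists_eq_add_one.2 (ccwSteps_pos hτ h)
    rw [hk]
    apply Nat.succ_le_succ
    apply ccwSteps_le
    have := inv_pow_ccwSteps hτ ν x
    rw [hk, pow_succ', Perm.mul_apply] at this
    rw [← this, Perm.inv_def, Equiv.apply_symm_apply]

/-- One step beyond `τ ν` the circle closes up at `ν`, so step counts may be reduced modulo `m + 1`.
-/
theorem ccwSteps_le_apply_self [Finite α] (hτ : τ.IsCycleOn Set.univ) (ν x : α) :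
    ccwSteps τ ν x ≤ ccwSteps τ ν (τ ν) := by
  set m := ccwSteps τ ν (τ ν) with hm
  have hp : (τ⁻¹ ^ (m + 1)) ν = ν := by
    rw [pow_succ', Perm.mul_apply, inv_pow_ccwSteps hτ, Perm.inv_def, Equiv.symm_apply_apply]
  have hx := inv_pow_ccwSteps hτ ν x
  set k := ccwSteps τ ν x
  have : (τ⁻¹ ^ (k % (m + 1))) ν = x := by
    rw [← Nat.mod_add_div k (m + 1), pow_add, Perm.mul_apply, pow_mul] at hx
    rwa [Perm.pow_apply_eq_self_of_apply_eq_self hp] at hx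
  exact (ccwSteps_le this).trans (Nat.lt_succ_iff.1 (Nat.mod_lt _ (Nat.succ_pos m)))

/-- A set that the circle leaves at most once is a consecutive piece. -/
theorem isConsecutivePiece_of_exit_unique [Finite α] (hτ : τ.IsCycleOn Set.univ) {P : Set α}
    (hne : P.Nonempty) (h : ∀ x ∈ P, ∀ y ∈ P, τ x ∉ P → τ y ∉ P → x = y) :
    IsConsecutivePiece τ P := by
  classical
  by_cases hex : ∃ x ∈ P, τ x ∉ P
  · obtain ⟨x, hx, hx'⟩ := hex
    have hk : ∃ k, (τ⁻¹ ^ k) x ∉ P := ⟨_, by rwa [inv_pow_ccwSteps hτ x (τ x)]⟩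
    have hpos : Nat.find hk ≠ 0 := fun h0 => by
      have := Nat.find_spec hk
      rw [h0] at this
      exact this hx
    obtain ⟨k, hk'⟩ := Nat.exists_eq_add_one_of_ne_zero hpos
    have hmin : ∀ i ≤ k, (τ⁻¹ ^ i) x ∈ P := fun i hi =>
      not_not.1 (Nat.find_min hk (hk' ▸ Nat.lt_succ_of_le hi))
    have hlast : (τ⁻¹ ^ (k + 1)) x ∉ P := hk' ▸ Nat.find_spec hk
    have hadd : ∀ i j, i ≤ j → (τ ^ i) ((τ⁻¹ ^ j) x) = (τ⁻¹ ^ (j - i)) x := by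
      intro i j hij
      obtain ⟨l, rfl⟩ := Nat.exists_eq_add_of_le hij
      rw [Nat.add_sub_cancel_left, pow_add, Perm.mul_apply, inv_pow, Perm.inv_def, Equiv.apply_symm_apply]
    refine ⟨(τ⁻¹ ^ k) x, k + 1, Set.ext fun z => ⟨fun hz => ?_, ?_⟩⟩
    · have hz' := inv_pow_ccwSteps hτ x z
      have hlt : ccwSteps τ x z < k + 1 := by
        by_contra! hle
        -- Coming back into `P` would produce a second exit, hence `x` itself, and `z` would be
        -- reached from `x` in fewer steps than the minimum.
        have : ∀ j, k + 1 ≤ j → j ≤ ccwSteps τ x z → (τ⁻¹ ^ j) x ∉ P := by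
          intro j hj
          induction j, hj using Nat.le_induction with
          | base => exact fun _ => hlast
          | succ j hj ih =>
            intro hjz hmem
            have hτj : τ ((τ⁻¹ ^ (j + 1)) x) = (τ⁻¹ ^ j) x := by
              rw [pow_succ', Perm.mul_apply, Perm.inv_def, Equiv.apply_symm_apply]
            have e := h _ hmem _ hx (by rw [hτj]; exact ih (by lia)) hx'
            have : (τ⁻¹ ^ (ccwSteps τ x z - (j + 1))) x = z := by
              conv_rhs => rw [← hz', ← Nat.sub_add_cancel hjz, pow_add, Perm.mul_apply, e]
            have := ccwSteps_le this
            lia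
        exact this _ hle le_rfl (hz'.symm ▸ hz)
      refine ⟨k - ccwSteps τ x z, by lia, ?_⟩
      rw [hadd _ _ (by lia), Nat.sub_sub_self (by lia), hz']
    · rintro ⟨i, hi, rfl⟩
      rw [hadd _ _ (by lia)]
      exact hmin _ (by lia)
  · push Not at hex
    obtain ⟨x, hx⟩ := hne
    have hall : ∀ i : ℕ, (τ ^ i) x ∈ P := by
      intro i
      induction i with
      | zero => exact hx
      | succ i ih => rw [pow_succ', Perm.mul_apply]; exact hex _ ih
    -- Without an exit `P` is the whole circle, which `Nat.card α` steps cover.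
    refine ⟨x, Nat.card α, Set.ext fun z => ⟨fun _ => ?_, ?_⟩⟩
    · have := Fintype.ofFinite α
      have hτ' : τ.IsCycleOn ((Finset.univ : Finset α) : Set α) := by simpa using hτ
      obtain ⟨i, hi, hz⟩ := hτ'.exists_pow_eq (Finset.mem_univ x) (Finset.mem_univ z)
      refine ⟨i, ?_, hz⟩
      rw [Nat.card_eq_fintype_card]
      exact hi
    · rintro ⟨i, -, rfl⟩
      exact hall i

end Circle

/-- `P k` describes the moving point once exactly the factors of index at least `k` have acted; the
rightmost factor acts first, so `k` descends from `n` to `0`. -/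
theorem prod_ofFn_induction {α : Type*} {n : ℕ} {σ : Fin n → Perm α} {P : ℕ → α → Prop}
    (h : ∀ (j : Fin n) (y : α), P (j + 1) y → P j (σ j y)) {x : α} (hx : P n x) :
    P 0 ((List.ofFn σ).prod x) := by
  induction n generalizing P with
  | zero => simpa using hx
  | succ n ih =>
    rw [List.ofFn_succ, List.prod_cons, Perm.mul_apply]
    exact h 0 _ (ih (P := fun k => P (k + 1)) (fun j y hy => by simpa using h j.succ y hy) hx)

/-! ### Components after removal of a vertex -/

section Trace

variable {S α : Type*} {G : SimpleGraph (S ⊕ α)}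

theorem SimpleGraph.IsTree.exists_componentTrace_eq (hG : G.IsTree) {v : S ⊕ α}
    (c : (G.induce {v}ᶜ).ConnectedComponent) :
    ∃ u, G.Adj v u ∧ (∀ x (h : x ∈ ({v}ᶜ : Set (S ⊕ α))), ⟨x, h⟩ ∈ c.supp ↔ G.towards v x = u) ∧
      componentTrace G v c = {μ | G.towards v (Sum.inr μ) = u} := by
  obtain ⟨u, hu, h⟩ := hG.exists_mem_supp_iff_towards c
  refine ⟨u, hu, h, Set.ext fun μ => ⟨fun ⟨hμ, hc⟩ => (h _ hμ).1 hc, fun hμ => ?_⟩⟩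
  have hne : Sum.inr μ ∈ ({v}ᶜ : Set (S ⊕ α)) := by
    rintro rfl
    rw [Set.mem_ofPred_eq, hG.isAcyclic.towards_self] at hμ
    exact hu.ne hμ
  exact ⟨hne, (h _ hne).2 hμ⟩

theorem SimpleGraph.IsTree.partitionsIntoConsecutivePieces (hG : G.IsTree) {τ : Perm α}
    {v : S ⊕ α} (h : ∀ u, G.Adj v u → (∃ μ, G.towards v (Sum.inr μ) = u) ∧
      IsConsecutivePiece τ {μ | G.towards v (Sum.inr μ) = u}) :
    PartitionsIntoConsecutivePieces τ {μ | Sum.inr μ ≠ v} (componentTrace G v) where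
  nonempty c := by
    obtain ⟨u, hu, -, e⟩ := hG.exists_componentTrace_eq c
    rw [e]
    exact (h u hu).1
  disjoint c c' hc := Set.disjoint_left.2 fun μ ⟨_, h₁⟩ ⟨_, h₂⟩ => hc (h₁.symm.trans h₂)
  iUnion_eq := Set.ext fun μ => by
    rw [Set.mem_iUnion]
    exact ⟨fun ⟨_, hμ, _⟩ => hμ, fun hμ =>
      ⟨(G.induce {v}ᶜ).connectedComponentMk ⟨Sum.inr μ, hμ⟩, hμ, rfl⟩⟩
  consecutive c := by
    obtain ⟨u, hu, -, e⟩ := hG.exists_componentTrace_eq c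
    rw [e]
    exact (h u hu).2

end Trace

/-! ### Branches, blocks and their order on the circle -/

section Branch

variable {S α : Type*}

/-- The path from the `α`-vertex `a` to the `α`-vertex `x` starts with the edge to `t`. -/
def Branch (G : SimpleGraph (S ⊕ α)) (a : α) (t : S) (x : α) : Prop :=
  G.towards (Sum.inr a) (Sum.inr x) = Sum.inl t

/-- The path from the `S`-vertex `t` to the `α`-vertex `x` starts with the edge to `c`. -/
def Block (G : SimpleGraph (S ⊕ α)) (t : S) (c x : α) : Prop :=
  G.towards (Sum.inl t) (Sum.inr x) = Sum.inr c

/-- The branches at `ν`, met counterclockwise from `ν`, are in increasing order. -/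
def BranchesIncrease [LinearOrder S] (G : SimpleGraph (S ⊕ α)) (τ : Perm α) (ν : α) : Prop :=
  ∀ ⦃t t' : S⦄ ⦃x x' : α⦄, Branch G ν t x → Branch G ν t' x' → t < t' →
    ccwSteps τ ν x < ccwSteps τ ν x'

variable {G : SimpleGraph (S ⊕ α)}

theorem Branch.unique {a : α} {t t' : S} {x : α} (h : Branch G a t x) (h' : Branch G a t' x) :
    t = t' := Sum.inl_injective (h.symm.trans h')

theorem Branch.ne (hG : G.IsTree) {a : α} {t : S} {x : α} (h : Branch G a t x) : x ≠ a := by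
  rintro rfl
  rw [Branch, hG.isAcyclic.towards_self] at h
  cases h

theorem Branch.adj (hG : G.IsTree) {a : α} {t : S} {x : α} (h : Branch G a t x) :
    G.Adj (Sum.inr a) (Sum.inl t) := by
  rw [← h]
  exact hG.adj_towards fun e => h.ne hG (Sum.inr_injective e).symm

theorem SimpleGraph.IsBipartiteWith.exists_eq_inl_of_adj
    (hb : G.IsBipartiteWith (Set.range Sum.inl) (Set.range Sum.inr)) {a : α} {v : S ⊕ α}
    (h : G.Adj (Sum.inr a) v) : ∃ t, v = Sum.inl t := by
  rcases hb.mem_of_adj h with ⟨⟨t, ht⟩, -⟩ | ⟨-, t, ht⟩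
  · cases ht
  · exact ⟨t, ht.symm⟩

theorem SimpleGraph.IsBipartiteWith.exists_eq_inr_of_adj
    (hb : G.IsBipartiteWith (Set.range Sum.inl) (Set.range Sum.inr)) {t : S} {v : S ⊕ α}
    (h : G.Adj (Sum.inl t) v) : ∃ a, v = Sum.inr a := by
  rcases hb.mem_of_adj h with ⟨-, a, ha⟩ | ⟨⟨a, ha⟩, -⟩
  · exact ⟨a, ha.symm⟩
  · cases ha

theorem exists_branch (hG : G.IsTree)
    (hb : G.IsBipartiteWith (Set.range Sum.inl) (Set.range Sum.inr)) {a x : α} (h : x ≠ a) :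
    ∃ t, Branch G a t x :=
  hb.exists_eq_inl_of_adj (hG.adj_towards fun e => h (Sum.inr_injective e).symm)

theorem exists_block (hG : G.IsTree)
    (hb : G.IsBipartiteWith (Set.range Sum.inl) (Set.range Sum.inr)) (t : S) (x : α) :
    ∃ c, Block G t c x :=
  hb.exists_eq_inr_of_adj (hG.adj_towards Sum.inl_ne_inr)

theorem Block.adj (hG : G.IsTree) {t : S} {c x : α} (h : Block G t c x) :
    G.Adj (Sum.inr c) (Sum.inl t) := by
  rw [← h]
  exact (hG.adj_towards Sum.inl_ne_inr).symm

theorem Block.unique {t : S} {c c' x : α} (h : Block G t c x) (h' : Block G t c' x) : c = c' :=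
  Sum.inr_injective (h.symm.trans h')

theorem block_self (hG : G.IsTree) {t : S} {c : α} (h : G.Adj (Sum.inr c) (Sum.inl t)) :
    Block G t c c := hG.isAcyclic.towards_of_adj h.symm

theorem branch_iff_not_block (hG : G.IsTree) {t : S} {a x : α}
    (h : G.Adj (Sum.inr a) (Sum.inl t)) : Branch G a t x ↔ ¬ Block G t a x :=
  hG.towards_eq_iff h _

theorem branch_of_adj_of_adj (hG : G.IsTree) {a x : α} {t : S}
    (ha : G.Adj (Sum.inr a) (Sum.inl t)) (hx : G.Adj (Sum.inr x) (Sum.inl t)) (h : x ≠ a) :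
    Branch G a t x :=
  (hG.towards_eq_towards hx (fun e => h (Sum.inr_injective e)) Sum.inl_ne_inr).trans
    (hG.isAcyclic.towards_of_adj ha)

/-- The path from `x` to `y` through `t` avoids `a`, so it cannot leave a branch at `a`. -/
theorem Branch.congr (hG : G.IsTree) {a x y : α} {t u : S} (h : Branch G a u x)
    (hx : G.Adj (Sum.inr x) (Sum.inl t)) (hy : G.Adj (Sum.inr y) (Sum.inl t)) (hya : y ≠ a) :
    Branch G a u y := by
  have h₁ := hG.towards_eq_towards hx (fun e => h.ne hG (Sum.inr_injective e)) Sum.inl_ne_inr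
  have h₂ := hG.towards_eq_towards hy (fun e => hya (Sum.inr_injective e)) Sum.inl_ne_inr
  exact h₂.trans (h₁.symm.trans h)

variable [LinearOrder S] {τ : Perm α}

theorem BranchesIncrease.le_of_ccwSteps_le {ν : α}
    (h : BranchesIncrease G τ ν) {t t' : S} {x x' : α} (hx : Branch G ν t x)
    (hx' : Branch G ν t' x') (hle : ccwSteps τ ν x ≤ ccwSteps τ ν x') : t ≤ t' := by
  by_contra! hlt
  exact (h hx' hx hlt).not_ge hle

variable [Finite α]

theorem BranchesIncrease.le_of_apply (hτ : τ.IsCycleOn Set.univ) (hG : G.IsTree) {ν : α}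
    (h : BranchesIncrease G τ ν) {t t' : S} {x : α} (hx : Branch G ν t x)
    (hx' : Branch G ν t' (τ x)) : t' ≤ t := by
  by_contra! hlt
  have := h hx hx' hlt
  rw [ccwSteps_eq_add_one hτ (hx.ne hG)] at this
  lia

/-- Single clockwise steps suffice: walk from the farther point back towards `ν`, by induction on
its step count. -/
theorem branchesIncrease_of_le (hτ : τ.IsCycleOn Set.univ) (hG : G.IsTree)
    (hb : G.IsBipartiteWith (Set.range Sum.inl) (Set.range Sum.inr)) {ν : α}
    (h : ∀ t t' x, Branch G ν t x → Branch G ν t' (τ x) → t' ≤ t) : BranchesIncrease G τ ν := by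
  suffices ∀ n t t' x x', Branch G ν t x → Branch G ν t' x' → ccwSteps τ ν x' = n →
      ccwSteps τ ν x ≤ n → t ≤ t' from fun t t' x x' hx hx' hlt => by
    by_contra! hle
    exact (this _ _ _ _ _ hx' hx rfl hle).not_gt hlt
  intro n
  induction n with
  | zero => exact fun t t' x x' _ hx' hn => absurd hn (ccwSteps_pos hτ (hx'.ne hG)).ne'
  | succ n ih =>
    intro t t' x x' hx hx' hn hle
    rcases hle.eq_or_lt with he | hlt
    · obtain rfl := ccwSteps_injective hτ (he.trans hn.symm)
      exact (hx.unique hx').le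
    · have hs : ccwSteps τ ν (τ x') = n := by
        rw [ccwSteps_eq_add_one hτ (hx'.ne hG)] at hn
        lia
      have hne : τ x' ≠ ν := fun e => by
        have := ccwSteps_pos hτ (hx.ne hG)
        rw [e, ccwSteps_self] at hs
        lia
      obtain ⟨u, hu⟩ := exists_branch hG hb hne
      exact (ih _ _ _ _ hx hu hs (by lia)).trans (h _ _ _ hx' hu)

theorem BranchesIncrease.branch_of_between (hτ : τ.IsCycleOn Set.univ) (hG : G.IsTree)
    (hb : G.IsBipartiteWith (Set.range Sum.inl) (Set.range Sum.inr)) {ν : α}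
    (h : BranchesIncrease G τ ν) {t : S} {x y z : α} (hx : Branch G ν t x) (hz : Branch G ν t z)
    (hxy : ccwSteps τ ν x ≤ ccwSteps τ ν y) (hyz : ccwSteps τ ν y ≤ ccwSteps τ ν z) :
    Branch G ν t y := by
  have hy : y ≠ ν := fun e => by
    have := ccwSteps_pos hτ (hx.ne hG)
    rw [e, ccwSteps_self] at hxy
    lia
  obtain ⟨u, hu⟩ := exists_branch hG hb hy
  rwa [(h.le_of_ccwSteps_le hx hu hxy).antisymm (h.le_of_ccwSteps_le hu hz hyz)]

/-- A branch is an interval for the step count from `ν`, so only its point nearest to `ν` can be an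
exit. -/
theorem BranchesIncrease.exit_unique (hτ : τ.IsCycleOn Set.univ) (hG : G.IsTree)
    (hb : G.IsBipartiteWith (Set.range Sum.inl) (Set.range Sum.inr)) {ν : α}
    (h : BranchesIncrease G τ ν) {t : S} {x y : α} (hx : Branch G ν t x) (hy : Branch G ν t y)
    (hx' : ¬ Branch G ν t (τ x)) (hy' : ¬ Branch G ν t (τ y)) : x = y := by
  have key : ∀ x y, Branch G ν t x → Branch G ν t y → ¬ Branch G ν t (τ y) →
      ¬ ccwSteps τ ν x < ccwSteps τ ν y := by
    intro x y hx hy hy' hlt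
    rw [ccwSteps_eq_add_one hτ (hy.ne hG)] at hlt
    refine hy' (h.branch_of_between hτ hG hb hx hy (Nat.lt_succ_iff.1 hlt) ?_)
    rw [ccwSteps_eq_add_one hτ (hy.ne hG)]
    lia
  exact ccwSteps_injective hτ ((not_lt.1 (key y x hy hx hx')).antisymm
    (not_lt.1 (key x y hx hy hy')))

theorem BranchesIncrease.enter_unique (hτ : τ.IsCycleOn Set.univ) (hG : G.IsTree)
    (hb : G.IsBipartiteWith (Set.range Sum.inl) (Set.range Sum.inr)) {ν : α}
    (h : BranchesIncrease G τ ν) {t : S} {x y : α} (hx : ¬ Branch G ν t x)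
    (hy : ¬ Branch G ν t y) (hx' : Branch G ν t (τ x)) (hy' : Branch G ν t (τ y)) : x = y := by
  have key : ∀ x y, ¬ Branch G ν t x → Branch G ν t (τ x) → Branch G ν t (τ y) →
      ¬ ccwSteps τ ν (τ x) < ccwSteps τ ν (τ y) := by
    intro x y hx hx' hy' hlt
    by_cases he : x = ν
    -- An entry directly from `ν` is at `τ ν`, which has the largest step count.
    · subst he
      exact hlt.not_ge (ccwSteps_le_apply_self hτ x _)
    · refine hx (h.branch_of_between hτ hG hb hx' hy' ?_ ?_) <;>
        rw [ccwSteps_eq_add_one hτ he] <;> lia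
  exact τ.injective <| ccwSteps_injective hτ ((not_lt.1 (key y x hy hy' hx')).antisymm
    (not_lt.1 (key x y hx hx' hy')))

/-- Leaving the block of `c` at `t` is the same as entering the branch of `t` at `c`. -/
theorem BranchesIncrease.block_exit_unique (hτ : τ.IsCycleOn Set.univ) (hG : G.IsTree)
    (hb : G.IsBipartiteWith (Set.range Sum.inl) (Set.range Sum.inr)) {c : α}
    (h : BranchesIncrease G τ c) {t : S} {x y : α} (hx : Block G t c x) (hy : Block G t c y)
    (hx' : ¬ Block G t c (τ x)) (hy' : ¬ Block G t c (τ y)) : x = y := by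
  have hc := fun z => branch_iff_not_block (x := z) hG (hx.adj hG)
  exact h.enter_unique hτ hG hb ((hc x).not.2 (not_not.2 hx)) ((hc y).not.2 (not_not.2 hy))
    ((hc _).2 hx') ((hc _).2 hy')

/-- Under the order condition branches are automatically arcs; `hdeg` supplies the nonemptiness of
the pieces. -/
theorem hasCICPP_iff (hτ : τ.IsCycleOn Set.univ) (hG : G.IsTree)
    (hb : G.IsBipartiteWith (Set.range Sum.inl) (Set.range Sum.inr)) {ν : α}
    (hdeg : ∀ t, G.Adj (Sum.inr ν) (Sum.inl t) → ∃ x, Branch G ν t x) :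
    HasCICPP G τ ν ↔ BranchesIncrease G τ ν := by
  constructor
  · intro h t t' x x' hx hx' hlt
    have key : ∀ {t x}, Branch G ν t x → x ∈ componentTrace G (Sum.inr ν)
        ((G.induce {Sum.inr ν}ᶜ).connectedComponentMk ⟨Sum.inl t, by simp⟩) := by
      intro t x hx
      have hxν : Sum.inr x ∈ ({Sum.inr ν}ᶜ : Set (S ⊕ α)) :=
        fun e => hx.ne hG (Sum.inr_injective e)
      refine ⟨hxν, ?_⟩
      have := hG.reachable_induce_towards hxν (by rw [show G.towards _ _ = _ from hx]; simp)
      refine SimpleGraph.ConnectedComponent.eq.2 (this.symm.trans ?_)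
      simp only [show G.towards _ _ = _ from hx]
      exact SimpleGraph.Reachable.refl _
    exact h.increasing t t' (hx.adj hG) (hx'.adj hG) hlt _ _ rfl rfl _ (key hx) _ (key hx')
  · intro h
    refine ⟨?_, fun t t' ht ht' hlt c c' hc hc' μ hμ μ' hμ' => ?_⟩
    · convert hG.partitionsIntoConsecutivePieces (τ := τ) (v := Sum.inr ν) ?_ using 1
      · ext; simp
      · intro u hu
        obtain ⟨t, rfl⟩ := hb.exists_eq_inl_of_adj hu
        exact ⟨hdeg t hu, isConsecutivePiece_of_exit_unique hτ (hdeg t hu) fun x hx y hy hx' hy' =>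
          h.exit_unique hτ hG hb hx hy hx' hy'⟩
    · obtain ⟨u, -, hu, e⟩ := hG.exists_componentTrace_eq c
      obtain ⟨u', -, hu', e'⟩ := hG.exists_componentTrace_eq c'
      have h₁ := (hu _ _).1 hc
      have h₂ := (hu' _ _).1 hc'
      rw [hG.isAcyclic.towards_of_adj ht] at h₁
      rw [hG.isAcyclic.towards_of_adj ht'] at h₂
      subst h₁ h₂
      rw [e] at hμ
      rw [e'] at hμ'
      exact h hμ hμ' hlt

theorem hasCPP_of_branchesIncrease (hτ : τ.IsCycleOn Set.univ) (hG : G.IsTree)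
    (hb : G.IsBipartiteWith (Set.range Sum.inl) (Set.range Sum.inr))
    (h : ∀ ν, BranchesIncrease G τ ν) (t : S) : HasCPP G τ t := by
  rw [HasCPP]
  convert hG.partitionsIntoConsecutivePieces (τ := τ) (v := Sum.inl t) ?_ using 1
  · ext; simp
  · intro u hu
    obtain ⟨c, rfl⟩ := hb.exists_eq_inr_of_adj hu
    have hne : ∃ μ, Block G t c μ := ⟨c, block_self hG hu.symm⟩
    exact ⟨hne, isConsecutivePiece_of_exit_unique hτ hne fun x hx y hy hx' hy' =>
      (h c).block_exit_unique hτ hG hb hx hy hx' hy'⟩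

end Branch

/-! ### Edge count and connectedness of factorization graphs -/

section Factorization

variable {S α : Type*} {n : ℕ} {s : Fin n ≃ S} {e : Fin n → ℕ} {G : SimpleGraph (S ⊕ α)}

theorem IsBipartiteOfType.card_edgeSet [Finite α] (hG : IsBipartiteOfType s e G) :
    Nat.card G.edgeSet = ∑ j, e j := by
  classical
  have := Fintype.ofFinite α
  have := Fintype.ofEquiv _ s
  have hb : G.IsBipartiteWith
      ((Finset.univ.map Function.Embedding.inl : Finset (S ⊕ α)) : Set (S ⊕ α))
      ((Finset.univ.map Function.Embedding.inr : Finset (S ⊕ α)) : Set (S ⊕ α)) := by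
    simpa using hG.isBipartiteWith
  have := SimpleGraph.isBipartiteWith_sum_degrees_eq_card_edges hb
  rw [Nat.card_eq_fintype_card, ← SimpleGraph.edgeFinset_card, ← this, Finset.sum_map,
    ← s.sum_comp]
  refine Finset.sum_congr rfl fun j _ => ?_
  rw [← hG.ncard_neighborSet j, ← SimpleGraph.card_neighborSet_eq_degree, ← Nat.card_eq_fintype_card]
  rfl

theorem IsBipartiteOfType.isTree_iff [Fintype α] (hG : IsBipartiteOfType s e G) :
    G.IsTree ↔ G.Connected ∧ ∑ j, ((e j : ℤ) - 1) = (Fintype.card α : ℤ) - 1 := by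
  have : Finite S := Finite.of_equiv _ s
  rw [SimpleGraph.isTree_iff_connected_and_card, hG.card_edgeSet, Nat.card_sum,
    ← Nat.card_congr s, Nat.card_fin, Nat.card_eq_fintype_card, Finset.sum_sub_distrib]
  simp only [Finset.sum_const, Finset.card_univ, Fintype.card_fin, nsmul_eq_mul, mul_one,
    ← Nat.cast_sum]
  refine and_congr_right fun _ => ?_
  lia

theorem IsBipartiteOfType.exists_branch (hG : IsBipartiteOfType s e G) (he : ∀ j, 2 ≤ e j)
    (hT : G.IsTree) {ν : α} {t : S} (h : G.Adj (Sum.inr ν) (Sum.inl t)) :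
    ∃ x, Branch G ν t x := by
  obtain ⟨j, rfl⟩ := s.surjective t
  have hc : 1 < (G.neighborSet (Sum.inl (s j))).ncard := by
    rw [hG.ncard_neighborSet]
    exact he j
  obtain ⟨v, hv, hne⟩ := Set.exists_ne_of_one_lt_ncard hc (Sum.inr ν)
  obtain ⟨x, rfl⟩ := hG.isBipartiteWith.exists_eq_inr_of_adj hv
  exact ⟨x, branch_of_adj_of_adj hT h hv.symm fun e => hne (congrArg _ e)⟩

variable [Fintype α] [DecidableEq α] {σ : Fin n → Perm α} {τ : Perm α}

theorem factorizationGraph_adj_iff {a : α} {j : Fin n} :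
    (factorizationGraph s σ).Adj (Sum.inr a) (Sum.inl (s j)) ↔ a ∈ (σ j).support := by
  constructor
  · rintro ⟨i, ν, hν, h⟩
    rcases Sym2.eq_iff.1 h with ⟨h₁, -⟩ | ⟨h₁, h₂⟩
    · cases h₁
    · rw [Sum.inr_injective h₁, s.injective (Sum.inl_injective h₂)]
      exact hν
  · exact fun h => ⟨j, a, h, Sym2.eq_swap⟩

theorem factorizationGraph_isBipartiteWith :
    (factorizationGraph s σ).IsBipartiteWith (Set.range Sum.inl) (Set.range Sum.inr) where
  disjoint := Set.disjoint_left.2 (by rintro _ ⟨a, rfl⟩ ⟨b, hb⟩; cases hb)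
  mem_of_adj v w := by
    rintro ⟨j, ν, -, h⟩
    rcases Sym2.eq_iff.1 h with ⟨rfl, rfl⟩ | ⟨rfl, rfl⟩ <;> simp

theorem eq_factorizationGraph (hb : G.IsBipartiteWith (Set.range Sum.inl) (Set.range Sum.inr))
    (h : ∀ j a, a ∈ (σ j).support ↔ G.Adj (Sum.inr a) (Sum.inl (s j))) :
    G = factorizationGraph s σ := by
  have key : ∀ a t, G.Adj (Sum.inr a) (Sum.inl t) ↔
      (factorizationGraph s σ).Adj (Sum.inr a) (Sum.inl t) := by
    intro a t
    obtain ⟨j, rfl⟩ := s.surjective t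
    rw [factorizationGraph_adj_iff, h]
  have hb' := factorizationGraph_isBipartiteWith (s := s) (σ := σ)
  ext v w
  rcases v with t | a <;> rcases w with u | b
  · exact iff_of_false (fun h => by cases (hb.exists_eq_inr_of_adj h).choose_spec)
      (fun h => by cases (hb'.exists_eq_inr_of_adj h).choose_spec)
  · rw [SimpleGraph.adj_comm, key, SimpleGraph.adj_comm]
  · exact key a u
  · exact iff_of_false (fun h => by cases (hb.exists_eq_inl_of_adj h).choose_spec)
      (fun h => by cases (hb'.exists_eq_inl_of_adj h).choose_spec)

theorem reachable_apply {j : Fin n} (y : α) :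
    (factorizationGraph s σ).Reachable (Sum.inr y) (Sum.inr (σ j y)) := by
  by_cases h : σ j y = y
  · rw [h]
  · have hy : y ∈ (σ j).support := Perm.mem_support.2 h
    exact (factorizationGraph_adj_iff.2 hy).reachable.trans
      (factorizationGraph_adj_iff.2 (Perm.apply_mem_support.2 hy)).symm.reachable

/-- Each factor moves a point along a path of length two, so the single orbit of `τ` lies in one
component; every `S`-vertex is attached to it because a cycle moves something. -/
theorem IsFactorizationOfType.connected [Nonempty α] (hτ : τ.IsCycleOn Set.univ)
    (h : IsFactorizationOfType τ e σ) : (factorizationGraph s σ).Connected := by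
  have hτx : ∀ x, (factorizationGraph s σ).Reachable (Sum.inr x) (Sum.inr (τ x)) := by
    intro x
    rw [← h.prod_eq]
    exact prod_ofFn_induction
      (P := fun _ y => (factorizationGraph s σ).Reachable (Sum.inr x) (Sum.inr y))
      (fun j y hy => hy.trans (reachable_apply y)) (.refl _)
  have hpow : ∀ x (k : ℕ), (factorizationGraph s σ).Reachable (Sum.inr x) (Sum.inr ((τ ^ k) x)) := by
    intro x k
    induction k with
    | zero => exact .refl _
    | succ k ih =>
      rw [pow_succ', Perm.mul_apply]
      exact ih.trans (hτx _)
  obtain ⟨x⟩ := ‹Nonempty α›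
  have hr : ∀ y, (factorizationGraph s σ).Reachable (Sum.inr x) (Sum.inr y) := fun y => by
    obtain ⟨k, rfl⟩ := hτ.exists_pow_eq' Set.finite_univ (Set.mem_univ x) (Set.mem_univ y)
    exact hpow x k
  refine SimpleGraph.connected_iff_exists_forall_reachable _ |>.2 ⟨Sum.inr x, ?_⟩
  rintro (t | y)
  · obtain ⟨j, rfl⟩ := s.surjective t
    obtain ⟨y, hy, -⟩ := h.isCycle j
    exact (hr y).trans (factorizationGraph_adj_iff.2 (Perm.mem_support.2 hy)).reachable
  · exact hr y

end Factorization

/-! ### Passing between factorizations and ordered trees -/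

section Ordered

variable {S α : Type*} [LinearOrder S] {n : ℕ} {s : Fin n ≃o S} {e : Fin n → ℕ}
  {G : SimpleGraph (S ⊕ α)} {σ : Fin n → Perm α} {τ : Perm α}

/-- The cyclic order in which the circle meets the blocks at `t`, as a cycle on the neighbours
of `t`. -/
theorem exists_isCycle_of_block [Finite α] (hτ : τ.IsCycleOn Set.univ) (hT : G.IsTree)
    (hb : G.IsBipartiteWith (Set.range Sum.inl) (Set.range Sum.inr))
    (h : ∀ ν, BranchesIncrease G τ ν) (t : S) (ht : ∃ a, G.Adj (Sum.inr a) (Sum.inl t))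
    (hdeg : ∀ a, G.Adj (Sum.inr a) (Sum.inl t) → ∃ x, Branch G a t x) :
    ∃ σ : Perm α, σ.IsCycle ∧ (∀ a, σ a ≠ a ↔ G.Adj (Sum.inr a) (Sum.inl t)) ∧
      ∀ a c x, Block G t a x → Block G t c (τ x) → a ≠ c → σ a = c := by
  classical
  choose ρ hρ using exists_block hT hb t
  let N := {a // G.Adj (Sum.inr a) (Sum.inl t)}
  let r : α → N := fun x => ⟨ρ x, (hρ x).adj hT⟩
  have hr : ∀ a : N, r a = a := fun a => Subtype.ext ((hρ a).unique (block_self hT a.2))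
  have hpow : ∀ x y : α, ∃ k : ℕ, (τ ^ k) x = y := fun x y =>
    hτ.exists_pow_eq' Set.finite_univ (Set.mem_univ x) (Set.mem_univ y)
  -- A block without exit would be the whole circle, but `hdeg` gives a point outside it.
  have hexit : ∀ a : N, ∃ x, r x = a ∧ r (τ x) ≠ a := by
    intro a
    by_contra! hcl
    obtain ⟨z, hz⟩ := hdeg a a.2
    obtain ⟨k, rfl⟩ := hpow a z
    have : ∀ k : ℕ, r ((τ ^ k) a) = a := by
      intro k
      induction k with
      | zero => exact hr a
      | succ k ih => rw [pow_succ', Perm.mul_apply]; exact hcl _ ih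
    refine (branch_iff_not_block hT a.2).1 hz ?_
    have hk : Block G t (r ((τ ^ k) a)) _ := hρ ((τ ^ k) a)
    rwa [this k] at hk
  choose ex hex hex' using hexit
  let f : N → N := fun a => r (τ (ex a))
  have hblock : ∀ {x a}, r x = a ↔ Block G t a x := fun {x a} =>
    ⟨fun e => e ▸ hρ x, fun hB => Subtype.ext ((hρ x).unique hB)⟩
  have hstep : ∀ x, r (τ x) ≠ r x → r (τ x) = f (r x) := by
    intro x hx
    have : x = ex (r x) := (h (r x)).block_exit_unique hτ hT hb (hblock.1 rfl)
      (hblock.1 (hex _)) (fun hB => hx (hblock.2 hB)) (fun hB => hex' _ (hblock.2 hB))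
    exact congrArg (fun z => r (τ z)) this
  have hiter : ∀ x (k : ℕ), ∃ m, f^[m] (r x) = r ((τ ^ k) x) := by
    intro x k
    induction k with
    | zero => exact ⟨0, rfl⟩
    | succ k ih =>
      obtain ⟨m, hm⟩ := ih
      rw [pow_succ', Perm.mul_apply]
      by_cases hx : r (τ ((τ ^ k) x)) = r ((τ ^ k) x)
      · exact ⟨m, hm.trans hx.symm⟩
      · exact ⟨m + 1, by rw [Function.iterate_succ_apply', hm, hstep _ hx]⟩
  have htrans : ∀ a b : N, ∃ m, f^[m] a = b := by
    intro a b
    obtain ⟨k, hk⟩ := hpow a b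
    obtain ⟨m, hm⟩ := hiter a k
    exact ⟨m, by rw [hr, hk, hr] at hm; exact hm⟩
  -- Starting the iteration at `f b` guarantees at least one application of `f`.
  have hsurj : Function.Surjective f := fun b => by
    obtain ⟨m, hm⟩ := htrans (f b) b
    exact ⟨f^[m] b, by rw [← Function.iterate_succ_apply' f, Function.iterate_succ_apply, hm]⟩
  let g : Perm N := Equiv.ofBijective f ⟨Finite.injective_iff_surjective.2 hsurj, hsurj⟩
  have hg : ∀ (m : ℕ) a, (g ^ m) a = f^[m] a := fun m a => by
    rw [Perm.coe_pow]; rfl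
  have hσ : ∀ a : N, Perm.ofSubtype g a = f a := fun a => Perm.ofSubtype_apply_coe g a
  have hsupp : ∀ a, Perm.ofSubtype g a ≠ a ↔ G.Adj (Sum.inr a) (Sum.inl t) := by
    intro a
    by_cases ha : G.Adj (Sum.inr a) (Sum.inl t)
    · refine iff_of_true (fun e => hex' ⟨a, ha⟩ ?_) ha
      exact Subtype.ext ((hσ ⟨a, ha⟩).symm.trans e)
    · exact iff_of_false (not_not.2 (Perm.ofSubtype_apply_of_not_mem g ha)) ha
  refine ⟨Perm.ofSubtype g, ?_, hsupp, fun a c x ha hc hac => ?_⟩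
  · obtain ⟨a, ha⟩ := ht
    refine ⟨a, (hsupp a).2 ha, fun b hb' => ?_⟩
    obtain ⟨m, hm⟩ := htrans ⟨a, ha⟩ ⟨b, (hsupp b).1 hb'⟩
    refine ⟨m, ?_⟩
    rw [zpow_natCast, ← map_pow]
    exact (Perm.ofSubtype_apply_coe (g ^ m) ⟨a, ha⟩).trans (by rw [hg, hm])
  · have e₁ : r x = ⟨a, ha.adj hT⟩ := hblock.2 ha
    have e₂ : r (τ x) = ⟨c, hc.adj hT⟩ := hblock.2 hc
    have := hstep x (by rw [e₁, e₂]; exact fun e => hac (congrArg Subtype.val e).symm)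
    rw [e₁, e₂] at this
    rw [hσ ⟨a, ha.adj hT⟩, ← this]

theorem prod_eq_of_block [Finite α] (hτ : τ.IsCycleOn Set.univ) (hT : G.IsTree)
    (hb : G.IsBipartiteWith (Set.range Sum.inl) (Set.range Sum.inr))
    (h : ∀ ν, BranchesIncrease G τ ν)
    (hdeg : ∀ t a, G.Adj (Sum.inr a) (Sum.inl t) → ∃ x, Branch G a t x)
    (hsupp : ∀ j a, σ j a ≠ a ↔ G.Adj (Sum.inr a) (Sum.inl (s j)))
    (hσ : ∀ j a c x, Block G (s j) a x → Block G (s j) c (τ x) → a ≠ c → σ j a = c) :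
    (List.ofFn σ).prod = τ := by
  ext x
  -- The edge from `y` towards `τ x` belongs to a factor still to act, the edge back towards `x` to
  -- one that has acted. At `k = 0` nothing is left to act, so `y = τ x`.
  have := prod_ofFn_induction (σ := σ) (x := x) (P := fun k y =>
    (∀ u, Branch G y (s u) (τ x) → u < k) ∧ ∀ u : Fin n, Branch G y (s u) x → k ≤ u) ?_
    ⟨fun u _ => u.2, fun u hu => absurd rfl (hu.ne hT)⟩
  · by_contra hne
    obtain ⟨t, ht⟩ := exists_branch hT hb (Ne.symm hne)
    obtain ⟨u, rfl⟩ := s.surjective t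
    exact absurd (this.1 u ht) (Nat.not_lt_zero _)
  rintro j y ⟨h₁, h₂⟩
  by_cases hj : Branch G y (s j) (τ x)
  · have hxy : Block G (s j) y x := by
      by_contra hB
      have := h₂ j ((branch_iff_not_block hT (hj.adj hT)).2 hB)
      lia
    obtain ⟨c, hc⟩ := exists_block hT hb (s j) (τ x)
    have hyc : y ≠ c := by
      rintro rfl
      exact (branch_iff_not_block hT (hj.adj hT)).1 hj hc
    rw [hσ j y c x hxy hc hyc]
    have hx : Branch G c (s j) x :=
      (branch_iff_not_block hT (hc.adj hT)).2 fun hB => hyc (hxy.unique hB)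
    refine ⟨fun u hu => ?_, fun u hu => ?_⟩
    -- The order condition at `c` bounds the next label by `j`; equality fails because `τ x` lies in
    -- the block of `c` at `s j`.
    · have hle := s.le_iff_le.1 ((h c).le_of_apply hτ hT hx hu)
      refine Fin.lt_def.1 (lt_of_le_of_ne hle ?_)
      rintro rfl
      exact (branch_iff_not_block hT (hc.adj hT)).1 hu hc
    · rw [s.injective (hx.unique hu)]
  -- Otherwise the branch `s j` at `y` has a point `z`. Seen counterclockwise from `y`, it comes
  -- strictly after `τ x` and, if `x ≠ y`, strictly before `x`, although these two are consecutive.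
  -- If `x = y`, then `τ x` is already the last point.
  · have hfix : σ j y = y := by
      by_contra hne
      obtain ⟨z, hz⟩ := hdeg _ _ ((hsupp j y).1 hne)
      have hτz : ccwSteps τ y (τ x) < ccwSteps τ y z := by
        by_cases e : τ x = y
        · rw [e, ccwSteps_self]
          exact ccwSteps_pos hτ (hz.ne hT)
        · obtain ⟨t, ht⟩ := exists_branch hT hb e
          obtain ⟨u, rfl⟩ := s.surjective t
          refine h y ht hz (s.lt_iff_lt.2 (lt_of_le_of_ne ?_ ?_))
          · exact Fin.le_def.2 (Nat.lt_succ_iff.1 (h₁ u ht))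
          · rintro rfl
            exact hj ht
      by_cases e : x = y
      · subst e
        exact hτz.not_ge (ccwSteps_le_apply_self hτ x z)
      · obtain ⟨t, ht⟩ := exists_branch hT hb e
        obtain ⟨u, rfl⟩ := s.surjective t
        have := h y hz ht (s.lt_iff_lt.2 (Fin.lt_def.2 (h₂ u ht)))
        rw [ccwSteps_eq_add_one hτ e] at this
        lia
    rw [hfix]
    refine ⟨fun u hu => ?_, fun u hu => (Nat.le_succ _).trans (h₂ u hu)⟩
    have hne : u ≠ j := by
      rintro rfl
      exact hj hu
    have := h₁ u hu
    have := Fin.val_ne_of_ne hne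
    lia

variable [Fintype α] [DecidableEq α]

theorem IsFactorizationOfType.branchesIncrease (hτ : τ.IsCycleOn Set.univ)
    (h : IsFactorizationOfType τ e σ) (hT : (factorizationGraph s σ).IsTree) (ν : α) :
    BranchesIncrease (factorizationGraph s σ) τ ν := by
  have hadj : ∀ {a j}, σ j a ≠ a →
      (factorizationGraph s σ).Adj (Sum.inr a) (Sum.inl (s j)) := fun ha =>
    (factorizationGraph_adj_iff (s := s.toEquiv)).2 (Perm.mem_support.2 ha)
  refine branchesIncrease_of_le hτ hT (factorizationGraph_isBipartiteWith (s := s.toEquiv))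
    fun t t' x hx hx' => ?_
  obtain ⟨l, rfl⟩ := s.surjective t
  -- While the point waits at `ν`, the bound `k ≤ l` ensures that any factor still to act has index
  -- below `l`.
  have := prod_ofFn_induction (σ := σ) (x := x) (P := fun k y => (y = ν ∧ k ≤ l) ∨
    ∃ u ≤ l, Branch (factorizationGraph s σ) ν (s u) y) ?_ (Or.inr ⟨l, le_rfl, hx⟩)
  · rw [h.prod_eq] at this
    rcases this with ⟨h₁, -⟩ | ⟨u, hu, h₁⟩
    · exact absurd h₁ (hx'.ne hT)
    · rw [hx'.unique h₁]
      exact s.monotone hu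
  · intro j y hy
    by_cases hj : σ j y = y
    · rw [hj]
      exact hy.imp_left fun h => ⟨h.1, by lia⟩
    have h₁ := hadj hj
    have h₂ := hadj (a := σ j y) (j := j) fun h => hj ((σ j).injective h)
    rcases hy with ⟨rfl, hl⟩ | ⟨u, hu, hB⟩
    · exact Or.inr ⟨j, Fin.le_def.2 (by lia), branch_of_adj_of_adj hT h₁ h₂ hj⟩
    · by_cases hν : σ j y = ν
      · rw [hν] at h₂
        have := s.injective (hB.unique (branch_of_adj_of_adj hT h₂ h₁ (hB.ne hT)))
        exact Or.inl ⟨hν, this ▸ Fin.le_def.1 hu⟩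
      · exact Or.inr ⟨u, hu, hB.congr hT h₁ h₂ hν⟩

theorem isFactorizationGraph_of_branchesIncrease (hτ : τ.IsCycleOn Set.univ) (he : ∀ j, 2 ≤ e j)
    (hG : IsBipartiteOfType s e G) (hT : G.IsTree) (h : ∀ ν, BranchesIncrease G τ ν) :
    IsFactorizationGraph τ s e G := by
  have hb := hG.isBipartiteWith
  have hdeg : ∀ t a, G.Adj (Sum.inr a) (Sum.inl t) → ∃ x, Branch G a t x := fun t a =>
    hG.exists_branch (s := s.toEquiv) he hT
  have hne : ∀ j, ∃ a, G.Adj (Sum.inr a) (Sum.inl (s j)) := fun j => by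
    obtain ⟨v, hv⟩ := Set.nonempty_of_ncard_ne_zero
      (s := G.neighborSet (Sum.inl (s j))) (by rw [hG.ncard_neighborSet]; have := he j; lia)
    obtain ⟨a, rfl⟩ := hb.exists_eq_inr_of_adj hv
    exact ⟨a, hv.symm⟩
  choose σ hcyc hsupp hσ using fun j =>
    exists_isCycle_of_block hτ hT hb h (s j) (hne j) (hdeg (s j))
  refine ⟨σ, ⟨hcyc, fun j => ?_, prod_eq_of_block hτ hT hb h hdeg hsupp hσ⟩,
    eq_factorizationGraph (s := s.toEquiv) hb fun j a => Perm.mem_support.trans (hsupp j a)⟩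
  have : G.neighborSet (Sum.inl (s j)) = Sum.inr '' ((σ j).support : Set α) := by
    ext v
    constructor
    · intro hv
      obtain ⟨a, rfl⟩ := hb.exists_eq_inr_of_adj hv
      exact ⟨a, Perm.mem_support.2 ((hsupp j a).2 hv.symm), rfl⟩
    · rintro ⟨a, ha, rfl⟩
      exact ((hsupp j a).1 (Perm.mem_support.1 ha)).symm
  rw [← hG.ncard_neighborSet j, this, Set.ncard_image_of_injective _ Sum.inr_injective,
    Set.ncard_coe_finset]

end Ordered

theorem proposition4p3 {d n : ℕ} (hd : 1 ≤ d)
    (τ : Equiv.Perm (Fin d)) (hτ : τ.IsCycleOn Set.univ)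
    {S : Type*} [LinearOrder S] (s : Fin n ≃o S)
    (e : Fin n → ℕ) (he : ∀ j, 2 ≤ e j)
    (G : SimpleGraph (S ⊕ Fin d)) (hG : IsBipartiteOfType s e G) :
    ((∑ j, ((e j : ℤ) - 1) = (d : ℤ) - 1 ∧ IsFactorizationGraph τ s e G) ↔
      (G.IsTree ∧ ∀ ν : Fin d, HasCICPP G τ ν)) ∧
    ((∑ j, ((e j : ℤ) - 1) = (d : ℤ) - 1 ∧ IsFactorizationGraph τ s e G) →
      ∀ t : S, HasCPP G τ t) := by
  have : Nonempty (Fin d) := ⟨⟨0, hd⟩⟩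
  have hb := hG.isBipartiteWith
  have htree := hG.isTree_iff (s := s.toEquiv)
  rw [Fintype.card_fin] at htree
  have hcic : G.IsTree → ∀ ν, HasCICPP G τ ν ↔ BranchesIncrease G τ ν := fun hT ν =>
    hasCICPP_iff hτ hT hb fun t => hG.exists_branch (s := s.toEquiv) he hT
  have hfwd : (∑ j, ((e j : ℤ) - 1) = (d : ℤ) - 1 ∧ IsFactorizationGraph τ s e G) →
      G.IsTree ∧ ∀ ν, BranchesIncrease G τ ν := by
    rintro ⟨hsum, σ, hσ, rfl⟩
    have hT := htree.2 ⟨hσ.connected (s := s.toEquiv) hτ, hsum⟩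
    exact ⟨hT, hσ.branchesIncrease hτ hT⟩
  refine ⟨⟨fun h => ?_, fun ⟨hT, h⟩ => ?_⟩, fun h t => ?_⟩
  · obtain ⟨hT, hi⟩ := hfwd h
    exact ⟨hT, fun ν => (hcic hT ν).2 (hi ν)⟩
  · exact ⟨(htree.1 hT).2, isFactorizationGraph_of_branchesIncrease hτ he hG hT fun ν =>
      (hcic hT ν).1 (h ν)⟩
  · obtain ⟨hT, hi⟩ := hfwd h
    exact hasCPP_of_branchesIncrease hτ hT hb hi t
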